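/- Theorem. A hypergraph on a finite ground set $V$ is a family $\mathcal H\subseteq 2^V$. A set $T\subseteq V$ is a transversal of $\mathcal H$ if $T\cap H\ne\emptyset$ for all $H\in\mathcal H$; $\mathcal H$ is transversal-free if no $H\in\mathcal H$ is a transversal of $\mathcal H$, and minimal transversal-free if it is transversal-free and, for every proper subset $S\subsetneq V$ for which $\mathcal H_S=\{H\in\mathcal H\mid H\subseteq S\}$ is nonempty, $\mathcal H_S$ is not transversal-free. For $\mathcal H$ with $\emptyset\notin\mathcal H$, the positions of the game $NIM_{\mathcal H}$ are the vectors $x\in\mathbb Z_{\ge0}^V$; a move $x\to x'$ leads to any position $x'\le x$ with $\{i\mid x'_i<x_i\}\in\mathcal H$. Its Sprague–Grundy function is defined recursively by $\mathcal G_{\mathcal H}(x)=\min\big(\mathbb Z_{\ge 0}\setminus\{\mathcal G_{\mathcal H}(x')\mid x\to x'\}\big)$. Let $h_{\mathcal H}(x)$ be the maximum number of consecutive moves that can be made starting from $x$, let $e$ be the all-ones vector, and put $m=m(x)=\min_{i\in V}x_i$ (with $m=0$ if $V=\emptyset$) and $y=y_{\mathcal H}(x)=h_{\mathcal H}(x-m(x)e)+1$.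 The hypergraph $\mathcal H$ is JM if for every position $x$ $$\mathcal G_{\mathcal H}(x)=\begin{cases}h_{\mathcal H}(x)&\text{if } m\le\binom{y}{2},\\[2pt] \binom{y}{2}+\Big(\big(m-\binom{y}{2}-1\big)\bmod y\Big)&\text{otherwise.}\end{cases}$$ Let $G=(U,E)$ be a finite connected simple graph. For $F\subseteq E$ let $U(F)$ be the set of vertices incident with at least one edge of $F$. For an integer $k\ge1$ define the hypergraphs $\mathcal F_{e,c}(G,k)=\{F\subseteq E\mid |F|=k,\ (U(F),F)\text{ is connected}\}$ and $\mathcal F_{e,t}(G,k)=\{F\subseteq E\mid |F|=k,\ (U(F),F)\text{ is a tree}\}$ on the ground set $E$, and $\mathcal F_{v,*}(G,k)=\{U(F)\mid F\in\mathcal F_{e,*}(G,k)\}$, for $*\in\{c,t\}$, on the ground set $U$. Then, for each $*\in\{c,t\}$: (1) for every $k\ge2$, if $\mathcal F_{e,*}(G,k)$ is minimal transversal-free, then it is JM; (2) for every $k\ge1$, if $\mathcal F_{v,*}(G,k)$ is minimal transversal-free, then it is JM. -/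

import Mathlib

namespace HypergraphNim

/-! ### Hypergraphs: a hypergraph on the ground set `V` is a family `H : Set (Set V)` -/

/-- `T` meets every hyperedge of `H`. -/
def IsTransversal {V : Type*} (H : Set (Set V)) (T : Set V) : Prop :=
  ∀ A ∈ H, (T ∩ A).Nonempty

/-- No hyperedge of `H` is a transversal of `H`. -/
def TransversalFree {V : Type*} (H : Set (Set V)) : Prop :=
  ∀ A ∈ H, ¬ IsTransversal H A

/-- The induced subhypergraph: the hyperedges of `H` contained in `S`. -/
def induced {V : Type*} (H : Set (Set V)) (S : Set V) : Set (Set V) :=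
  {A | A ∈ H ∧ A ⊆ S}

/-- `H` is transversal-free, and no nonempty subhypergraph induced by a proper subset of the
ground set is transversal-free. -/
def MinimalTransversalFree {V : Type*} (H : Set (Set V)) : Prop :=
  TransversalFree H ∧
    ∀ S : Set V, S ≠ Set.univ → (induced H S).Nonempty → ¬ TransversalFree (induced H S)

/-! ### The game -/

/-- A move `x → y` of hypergraph NIM: the piles that change are strictly decreased, and they
form a hyperedge. The first conjunct `y < x` (that is, `y ≤ x` and `y ≠ x`) says that no pile
grows and that at least one pile shrinks; the latter is automatic when `∅ ∉ H`. -/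
def Move {V : Type*} (H : Set (Set V)) (x y : V → ℕ) : Prop :=
  y < x ∧ {i | y i < x i} ∈ H

/-- The minimal excludant. -/
noncomputable def mex (S : Set ℕ) : ℕ := sInf {n | n ∉ S}

/-- The Sprague–Grundy function of hypergraph NIM. -/
noncomputable def spragueGrundy {V : Type*} [Finite V] (H : Set (Set V)) (x : V → ℕ) : ℕ :=
  mex (Set.range fun y : {y : V → ℕ // Move H x y} => spragueGrundy H y.1)
termination_by (wellFounded_lt (α := V → ℕ)).wrap x
decreasing_by exact y.2.1

/-- The height: the maximum number of consecutive moves starting from `x`. (This set of numbers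
contains `0` and, the ground set being finite, it is bounded by the total number of stones.) -/
noncomputable def height {V : Type*} (H : Set (Set V)) (x : V → ℕ) : ℕ :=
  sSup {n | ∃ s : ℕ → V → ℕ, s 0 = x ∧ ∀ i < n, Move H (s i) (s (i + 1))}

/-- `m(x)`, the size of a smallest pile. -/
noncomputable def minPile {V : Type*} (x : V → ℕ) : ℕ := ⨅ i, x i

/-- `y(x) = h(x - m(x) e) + 1`, where `e` is the all-ones vector. -/
noncomputable def yValue {V : Type*} (H : Set (Set V)) (x : V → ℕ) : ℕ :=
  height H (fun i => x i - minPile x) + 1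

/-- `v(x) = C(y, 2) + ((m - C(y, 2) - 1) mod y)`. It is only used when `m > C(y, 2)`, so that the
subtractions of natural numbers are exact. -/
noncomputable def vValue {V : Type*} (H : Set (Set V)) (x : V → ℕ) : ℕ :=
  (yValue H x).choose 2 + (minPile x - (yValue H x).choose 2 - 1) % yValue H x

/-- The Jenkyns–Mayberry formula. -/
noncomputable def jmFormula {V : Type*} (H : Set (Set V)) (x : V → ℕ) : ℕ :=
  if minPile x ≤ (yValue H x).choose 2 then height H x else vValue H x

/-- `H` is a JM hypergraph: the JM formula gives the Sprague–Grundy value of every position. -/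
def IsJM {V : Type*} [Finite V] (H : Set (Set V)) : Prop :=
  ∀ x : V → ℕ, spragueGrundy H x = jmFormula H x

/-! ### The four hypergraphs of a graph -/

/-- The graph `(U, F)` for a set `F` of edges of `G = (U, E)`. -/
def edgeGraph {U : Type*} (G : SimpleGraph U) (F : Set G.edgeSet) : SimpleGraph U :=
  SimpleGraph.fromEdgeSet (Subtype.val '' F)

/-- `U(F)`: the vertices incident with at least one edge of `F`. -/
def supportingVertices {U : Type*} (G : SimpleGraph U) (F : Set G.edgeSet) : Set U :=
  (edgeGraph G F).support

/-- The graph `(U(F), F)`. -/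
def supportedGraph {U : Type*} (G : SimpleGraph U) (F : Set G.edgeSet) :
    SimpleGraph (supportingVertices G F) :=
  (edgeGraph G F).induce (supportingVertices G F)

/-- The sets of `k` edges of `G` that form a connected subgraph. -/
def edgeConnected {U : Type*} (G : SimpleGraph U) (k : ℕ) : Set (Set G.edgeSet) :=
  {F | F.ncard = k ∧ (supportedGraph G F).Connected}

/-- The sets of `k` edges of `G` that form a tree. -/
def edgeTree {U : Type*} (G : SimpleGraph U) (k : ℕ) : Set (Set G.edgeSet) :=
  {F | F.ncard = k ∧ (supportedGraph G F).IsTree}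

/-- The vertex sets of the connected subgraphs of `G` with `k` edges. -/
def vertexConnected {U : Type*} (G : SimpleGraph U) (k : ℕ) : Set (Set U) :=
  supportingVertices G '' edgeConnected G k

/-- The vertex sets of the subtrees of `G` with `k` edges. -/
def vertexTree {U : Type*} (G : SimpleGraph U) (k : ℕ) : Set (Set U) :=
  supportingVertices G '' edgeTree G k

end HypergraphNim

/-! It suffices that the Jenkyns–Mayberry value `g` is never preserved by a move and that every
smaller value is reached by one (`spragueGrundy_eq_of_forall`). Call a position long if `m ≤ C(y,
2)` and short otherwise.

Preservation is excluded by transversal-freeness alone (`jmFormula_ne_of_move`): the hyperedge moved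
in misses some hyperedge `B`, and the untouched piles of `B` bound the height after the move from
below.

Reaching values means controlling the height after a move. The height is the size of a largest
packing of hyperedges, and losing one stone lowers it by at most one, so the moves in a fixed
hyperedge `A` reach all heights between that of `zeroOn A x` and that of `decr A x`. Smaller heights
come from other hyperedges. Along a chain of hyperedges in which each has at most one element
outside its predecessor, these ranges leave no gap (`HasExchange.exists_move_of_chain`), and
minimality supplies an end of the chain whose removal leaves little height. From a long position
this reaches every `z` with `m ≤ z < h`; a value `z < m` not covered in this way is reached at a
short position with a prescribed pair `(m, y)`.

What remains is the exchange property for the four graph families. It follows by growing connected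
edge sets, or trees, one edge at a time (`IsGood.grow`, `edgeChain_of_common`). -/

namespace HypergraphNim

/-! ### Height as the size of a largest packing -/

open Classical in
/-- Decrease every pile of `A` by one. -/
noncomputable def decr {V : Type*} (A : Set V) (x : V → ℕ) : V → ℕ :=
  fun v => if v ∈ A then x v - 1 else x v

open Classical in
/-- Remove every pile of `A`. -/
noncomputable def zeroOn {V : Type*} (A : Set V) (x : V → ℕ) : V → ℕ :=
  fun v => if v ∈ A then 0 else x v

open Classical in
/-- The number of members of `Q` that contain `v`. -/
noncomputable def cover {V : Type*} (Q : Multiset (Set V)) (v : V) : ℕ :=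
  Q.countP fun A => v ∈ A

/-- `Q` is a packing of hyperedges of `H` into `x`. -/
def IsPacking {V : Type*} (H : Set (Set V)) (x : V → ℕ) (Q : Multiset (Set V)) : Prop :=
  (∀ A ∈ Q, A ∈ H) ∧ ∀ v, cover Q v ≤ x v

section Game

variable {V : Type*} {H : Set (Set V)}

theorem cover_cons_of_mem {A : Set V} {v : V} (h : v ∈ A) (Q : Multiset (Set V)) :
    cover (A ::ₘ Q) v = cover Q v + 1 := by
  simp [cover, h]

theorem cover_cons_of_notMem {A : Set V} {v : V} (h : v ∉ A) (Q : Multiset (Set V)) :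
    cover (A ::ₘ Q) v = cover Q v := by
  simp [cover, h]

theorem cover_le_cons (A : Set V) (v : V) (Q : Multiset (Set V)) :
    cover Q v ≤ cover (A ::ₘ Q) v := by
  by_cases h : v ∈ A
  · rw [cover_cons_of_mem h]; omega
  · rw [cover_cons_of_notMem h]

theorem cover_pos {Q : Multiset (Set V)} {A : Set V} {v : V} (hA : A ∈ Q) (h : v ∈ A) :
    0 < cover Q v := by
  classical
  exact Multiset.countP_pos.2 ⟨A, hA, h⟩

theorem cover_eq_zero {Q : Multiset (Set V)} {v : V} (h : ∀ A ∈ Q, v ∉ A) : cover Q v = 0 := by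
  classical
  exact Multiset.countP_eq_zero.2 h

theorem cover_eq_card {Q : Multiset (Set V)} {v : V} (h : ∀ A ∈ Q, v ∈ A) :
    cover Q v = Q.card := by
  classical
  exact Multiset.countP_eq_card.2 h

theorem move_of_eq {x q : V → ℕ} {A : Set V} (hA : A ∈ H) (hne : A.Nonempty)
    (hlt : ∀ v ∈ A, q v < x v) (heq : ∀ v ∉ A, q v = x v) : Move H x q := by
  have hle : q ≤ x := fun v => by
    by_cases h : v ∈ A
    · exact (hlt v h).le
    · exact (heq v h).le
  obtain ⟨a, ha⟩ := hne
  refine ⟨lt_of_le_of_ne hle fun h => (hlt a ha).ne (congrFun h a), ?_⟩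
  have : {i | q i < x i} = A := by
    ext v
    by_cases h : v ∈ A
    · simp [h, hlt v h]
    · simp [h, heq v h]
  rwa [this]

theorem move_decr {x : V → ℕ} {A : Set V} (hA : A ∈ H) (hne : A.Nonempty)
    (hpos : ∀ v ∈ A, 0 < x v) : Move H x (decr A x) := by
  refine move_of_eq hA hne (fun v hv => ?_) (fun v hv => ?_)
  · have := hpos v hv
    simp only [decr, hv, if_true]; omega
  · simp [decr, hv]

/-- The hyperedges of successive moves form a packing, since each move takes at least one stone from
each of its piles. Conversely, the members of a packing can be played in any order, one stone per
pile. -/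
theorem exists_moves_iff_exists_packing (hne : ∀ A ∈ H, A.Nonempty) (n : ℕ) :
    ∀ x : V → ℕ, (∃ s : ℕ → V → ℕ, s 0 = x ∧ ∀ i < n, Move H (s i) (s (i + 1))) ↔
      ∃ Q, IsPacking H x Q ∧ Q.card = n := by
  induction n with
  | zero =>
    intro x
    refine ⟨fun _ => ⟨0, ⟨by simp, by simp [cover]⟩, rfl⟩, fun _ => ⟨fun _ => x, rfl, by simp⟩⟩
  | succ n ih =>
    intro x
    constructor
    · rintro ⟨s, rfl, hs⟩
      obtain ⟨Q, ⟨hQ, hc⟩, hn⟩ := (ih (s 1)).1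
        ⟨fun i => s (i + 1), rfl, fun i hi => hs (i + 1) (by omega)⟩
      have h0 := hs 0 (by omega)
      refine ⟨{i | s 1 i < s 0 i} ::ₘ Q, ⟨?_, fun v => ?_⟩, by simp [hn]⟩
      · intro A hA
        rcases Multiset.mem_cons.1 hA with rfl | hA
        · exact h0.2
        · exact hQ A hA
      · by_cases h : s 1 v < s 0 v
        · rw [cover_cons_of_mem (by exact h)]
          have := hc v
          omega
        · rw [cover_cons_of_notMem (by exact h)]
          exact (hc v).trans (h0.1.le v)
    · rintro ⟨Q, ⟨hQ, hc⟩, hn⟩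
      obtain ⟨A, hA⟩ := Multiset.card_pos_iff_exists_mem.1 (by omega : 0 < Q.card)
      obtain ⟨Q, rfl⟩ := Multiset.exists_cons_of_mem hA
      have hAH := hQ A hA
      have hp : IsPacking H (decr A x) Q := by
        refine ⟨fun B hB => hQ B (Multiset.mem_cons_of_mem hB), fun v => ?_⟩
        have := hc v
        by_cases h : v ∈ A
        · rw [cover_cons_of_mem h] at this
          simp only [decr, h, if_true]; omega
        · rw [cover_cons_of_notMem h] at this
          simpa [decr, h] using this
      obtain ⟨s, hs0, hs⟩ := (ih (decr A x)).2 ⟨Q, hp, by simpa using hn⟩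
      refine ⟨fun i => Nat.casesOn i x s, rfl, fun i hi => ?_⟩
      cases i with
      | zero =>
        simp only [hs0]
        exact move_decr hAH (hne A hAH) fun v hv => (cover_pos hA hv).trans_le (hc v)
      | succ i => exact hs i (by omega)

theorem IsPacking.of_cons {x : V → ℕ} {A : Set V} {Q : Multiset (Set V)}
    (h : IsPacking H x (A ::ₘ Q)) : IsPacking H x Q :=
  ⟨fun B hB => h.1 B (Multiset.mem_cons_of_mem hB),
    fun v => (cover_le_cons A v Q).trans (h.2 v)⟩

theorem IsPacking.mono {x z : V → ℕ} {Q : Multiset (Set V)} (h : IsPacking H x Q) (hxz : x ≤ z) :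
    IsPacking H z Q :=
  ⟨h.1, fun v => (h.2 v).trans (hxz v)⟩

variable [Finite V]

theorem bddAbove_moves (H : Set (Set V)) (x : V → ℕ) :
    BddAbove {n | ∃ s : ℕ → V → ℕ, s 0 = x ∧ ∀ i < n, Move H (s i) (s (i + 1))} := by
  have := Fintype.ofFinite V
  refine ⟨∑ v, x v, ?_⟩
  rintro n ⟨s, rfl, hs⟩
  have key : ∀ i ≤ n, i + ∑ v, s i v ≤ ∑ v, s 0 v := by
    intro i
    induction i with
    | zero => simp
    | succ i ih =>
      intro hi
      have h1 := ih (by omega)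
      have h2 : ∑ v, s (i + 1) v < ∑ v, s i v := by
        obtain ⟨hle, v, hv⟩ := Pi.lt_def.1 (hs i (by omega)).1
        exact Finset.sum_lt_sum (fun v _ => hle v) ⟨v, Finset.mem_univ v, hv⟩
      omega
  have := key n le_rfl
  omega

theorem IsPacking.card_le_height (hne : ∀ A ∈ H, A.Nonempty) {x : V → ℕ} {Q : Multiset (Set V)}
    (h : IsPacking H x Q) : Q.card ≤ height H x :=
  le_csSup (bddAbove_moves H x) ((exists_moves_iff_exists_packing hne _ x).2 ⟨Q, h, rfl⟩)

theorem exists_packing_height (hne : ∀ A ∈ H, A.Nonempty) (x : V → ℕ) :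
    ∃ Q, IsPacking H x Q ∧ Q.card = height H x := by
  rw [← exists_moves_iff_exists_packing hne]
  exact Nat.sSup_mem
    (s := {n | ∃ s : ℕ → V → ℕ, s 0 = x ∧ ∀ i < n, Move H (s i) (s (i + 1))})
    ⟨0, fun _ => x, rfl, by simp⟩ (bddAbove_moves H x)

theorem height_mono (hne : ∀ A ∈ H, A.Nonempty) {x z : V → ℕ} (h : x ≤ z) :
    height H x ≤ height H z := by
  obtain ⟨Q, hQ, hc⟩ := exists_packing_height hne x
  rw [← hc]
  exact (hQ.mono h).card_le_height hne

theorem height_lt_of_move (hne : ∀ A ∈ H, A.Nonempty) {x z : V → ℕ} (h : Move H x z) :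
    height H z < height H x := by
  obtain ⟨Q, hQ, hc⟩ := exists_packing_height hne z
  rw [← hc]
  have : IsPacking H x ({i | z i < x i} ::ₘ Q) := by
    refine ⟨fun A hA => ?_, fun v => ?_⟩
    · rcases Multiset.mem_cons.1 hA with rfl | hA
      · exact h.2
      · exact hQ.1 A hA
    · have h1 := hQ.2 v
      by_cases hv : z v < x v
      · rw [cover_cons_of_mem (by exact hv)]; omega
      · rw [cover_cons_of_notMem (by exact hv)]
        exact h1.trans (h.1.le v)
  have := this.card_le_height hne
  rw [Multiset.card_cons] at this
  omega

-- A stone lost from pile `i` costs a packing at most one member: drop one that contains `i`, if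
-- there is any. This is the discrete continuity behind all intermediate value arguments for the
-- height.
open Classical in
theorem height_le_update_pred (hne : ∀ A ∈ H, A.Nonempty) (x : V → ℕ) (i : V) :
    height H x ≤ height H (Function.update x i (x i - 1)) + 1 := by
  obtain ⟨Q, hQ, hc⟩ := exists_packing_height hne x
  by_cases h : ∃ A ∈ Q, i ∈ A
  · obtain ⟨A, hA, hi⟩ := h
    obtain ⟨Q, rfl⟩ := Multiset.exists_cons_of_mem hA
    have : IsPacking H (Function.update x i (x i - 1)) Q := by
      refine ⟨hQ.of_cons.1, fun v => ?_⟩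
      by_cases hv : v = i
      · subst hv
        have := hQ.2 v
        rw [cover_cons_of_mem hi] at this
        rw [Function.update_self]; omega
      · rw [Function.update_of_ne hv]
        exact hQ.of_cons.2 v
    have := this.card_le_height hne
    rw [Multiset.card_cons] at hc
    omega
  · push Not at h
    have : IsPacking H (Function.update x i (x i - 1)) Q := by
      refine ⟨hQ.1, fun v => ?_⟩
      by_cases hv : v = i
      · subst hv
        rw [cover_eq_zero h]; omega
      · rw [Function.update_of_ne hv]
        exact hQ.2 v
    have := this.card_le_height hne
    omega

theorem le_height_of_forall_le (hne : ∀ A ∈ H, A.Nonempty) {x : V → ℕ} {A : Set V} (hA : A ∈ H)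
    {d : ℕ} (h : ∀ v ∈ A, d ≤ x v) : d ≤ height H x := by
  have : IsPacking H x (Multiset.replicate d A) := by
    refine ⟨fun B hB => (Multiset.eq_of_mem_replicate hB) ▸ hA, fun v => ?_⟩
    by_cases hv : v ∈ A
    · rw [cover_eq_card fun B hB => (Multiset.eq_of_mem_replicate hB) ▸ hv]
      simpa using h v hv
    · rw [cover_eq_zero fun B hB => (Multiset.eq_of_mem_replicate hB) ▸ hv]
      exact Nat.zero_le _
  simpa using this.card_le_height hne

theorem exists_height_decr (hne : ∀ A ∈ H, A.Nonempty) {x : V → ℕ} {Q : Multiset (Set V)}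
    (hQ : IsPacking H x Q) (hc : Q.card = height H x) {A : Set V} (hA : A ∈ Q) :
    A ∈ H ∧ (∀ v ∈ A, 0 < x v) ∧ height H x ≤ height H (decr A x) + 1 := by
  have hpos : ∀ v ∈ A, 0 < x v := fun v hv => (cover_pos hA hv).trans_le (hQ.2 v)
  obtain ⟨Q, rfl⟩ := Multiset.exists_cons_of_mem hA
  refine ⟨hQ.1 A hA, hpos, ?_⟩
  have : IsPacking H (decr A x) Q := by
    refine ⟨hQ.of_cons.1, fun v => ?_⟩
    have := hQ.2 v
    by_cases h : v ∈ A
    · rw [cover_cons_of_mem h] at this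
      simp only [decr, h, if_true]; omega
    · rw [cover_cons_of_notMem h] at this
      simpa [decr, h] using this
  have := this.card_le_height hne
  rw [Multiset.card_cons] at hc
  omega

/-- Between two comparable positions the height takes every intermediate value. -/
theorem exists_height_eq (hne : ∀ A ∈ H, A.Nonempty) {p q : V → ℕ} (hqp : q ≤ p) {z : ℕ}
    (h1 : height H q ≤ z) (h2 : z ≤ height H p) :
    ∃ c, q ≤ c ∧ c ≤ p ∧ height H c = z := by
  classical
  -- If a minimal position of height at least `z` overshot `z`, removing one more stone would
  -- contradict minimality.
  obtain ⟨c, ⟨hqc, hcp, hzc⟩, hmin⟩ := (wellFounded_lt (α := V → ℕ)).has_min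
    {c | q ≤ c ∧ c ≤ p ∧ z ≤ height H c} ⟨p, hqp, le_rfl, h2⟩
  refine ⟨c, hqc, hcp, le_antisymm ?_ hzc⟩
  by_contra hlt
  push Not at hlt
  have hne' : q ≠ c := by rintro rfl; omega
  obtain ⟨-, i, hi⟩ := Pi.lt_def.1 (lt_of_le_of_ne hqc hne')
  have hle : Function.update c i (c i - 1) ≤ c := by
    rw [update_le_self_iff]; omega
  have h3 := height_le_update_pred hne c i
  refine hmin (Function.update c i (c i - 1)) ⟨?_, hle.trans hcp, by omega⟩
    (lt_of_le_of_ne hle fun h => ?_)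
  · rw [le_update_iff]
    exact ⟨by omega, fun j _ => hqc j⟩
  · have := congrFun h i
    rw [Function.update_self] at this
    omega

/-- Every hyperedge still playable once `T` is emptied uses pile `i`, so each move costs a stone of
that pile. -/
theorem height_zeroOn_le {x : V → ℕ} (hne : ∀ A ∈ H, A.Nonempty) {T : Set V} {i : V}
    (h : ∀ A ∈ H, Disjoint A T → i ∈ A) : height H (zeroOn T x) ≤ x i := by
  obtain ⟨Q, hQ, hc⟩ := exists_packing_height hne (zeroOn T x)
  have hi : ∀ A ∈ Q, i ∈ A := by
    refine fun A hA => h A (hQ.1 A hA) (Set.disjoint_left.2 fun v hv hT => ?_)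
    have h1 := hQ.2 v
    have h2 := cover_pos hA hv
    simp only [zeroOn, hT, if_true] at h1
    omega
  have h1 := hQ.2 i
  rw [cover_eq_card hi, hc] at h1
  refine h1.trans ?_
  unfold zeroOn
  split_ifs <;> simp

theorem height_zeroOn_eq_zero {x : V → ℕ} (hne : ∀ A ∈ H, A.Nonempty) {T : Set V}
    (h : ∀ A ∈ H, (∀ v ∈ A, 0 < x v) → (T ∩ A).Nonempty) : height H (zeroOn T x) = 0 := by
  obtain ⟨Q, hQ, hc⟩ := exists_packing_height hne (zeroOn T x)
  by_contra h0
  obtain ⟨A, hA⟩ := Multiset.card_pos_iff_exists_mem.1 (by omega : 0 < Q.card)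
  have hpos : ∀ v ∈ A, 0 < zeroOn T x v := fun v hv => (cover_pos hA hv).trans_le (hQ.2 v)
  obtain ⟨v, hvT, hvA⟩ := h A (hQ.1 A hA) fun v hv => (hpos v hv).trans_le (by
    unfold zeroOn; split_ifs <;> simp)
  have := hpos v hvA
  simp [zeroOn, hvT] at this

end Game

/-! ### The exchange property and the heights reached by moves -/

/-- `B` is a hyperedge inside `S` with at most one element outside `A`. -/
def ExchangeStep {V : Type*} (H : Set (Set V)) (S A B : Set V) : Prop :=
  B ∈ H ∧ B ⊆ S ∧ ∃ c, B ⊆ insert c A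

/-- Intersecting hyperedges are joined by chains of exchanges inside their union, and every proper
nonempty set of vertices has an element outside it that hyperedges can be exchanged into. -/
structure HasExchange {V : Type*} (H : Set (Set V)) : Prop where
  nontrivial : ∀ A ∈ H, A.Nontrivial
  chain : ∀ A ∈ H, ∀ B ∈ H, (A ∩ B).Nonempty →
    Relation.ReflTransGen (ExchangeStep H (A ∪ B)) A B
  attach : ∀ C : Set V, C.Nonempty → C ≠ Set.univ →
    ∃ a ∈ C, ∃ c ∉ C, ∀ A ∈ H, a ∈ A → ∃ B ∈ H, c ∈ B ∧ B ⊆ insert c A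

section Moves

variable {V : Type*} {H : Set (Set V)}

theorem HasExchange.nonempty (hH : HasExchange H) : ∀ A ∈ H, A.Nonempty :=
  fun A hA => (hH.nontrivial A hA).nonempty

theorem exchangeChain_mono {S T : Set V} (h : S ⊆ T) {A B : Set V}
    (hAB : Relation.ReflTransGen (ExchangeStep H S) A B) :
    Relation.ReflTransGen (ExchangeStep H T) A B :=
  Relation.ReflTransGen.mono (p := ExchangeStep H T)
    (fun _ _ h' => ⟨h'.1, h'.2.1.trans h, h'.2.2⟩) _ _ hAB

/-- The hyperedges reachable from `A` cover the ground set, as otherwise `attach` would reach a new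
element. Hence one of them meets `B`, and `chain` completes the path. -/
theorem HasExchange.chain_univ (hH : HasExchange H) {A B : Set V} (hA : A ∈ H) (hB : B ∈ H) :
    Relation.ReflTransGen (ExchangeStep H Set.univ) A B := by
  let R : Set (Set V) := {C | C ∈ H ∧ Relation.ReflTransGen (ExchangeStep H Set.univ) A C}
  have hR : ⋃₀ R = Set.univ := by
    by_contra hne
    obtain ⟨a, ha⟩ := hH.nonempty A hA
    obtain ⟨a, ⟨C, hC, haC⟩, c, hc, h⟩ := hH.attach (⋃₀ R) ⟨a, A, ⟨hA, .refl⟩, ha⟩ hne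
    obtain ⟨D, hD, hcD, hsub⟩ := h C hC.1 haC
    exact hc ⟨D, ⟨hD, hC.2.tail ⟨hD, Set.subset_univ _, c, hsub⟩⟩, hcD⟩
  obtain ⟨b, hb⟩ := hH.nonempty B hB
  obtain ⟨C, hC, hbC⟩ : b ∈ ⋃₀ R := hR ▸ Set.mem_univ b
  exact hC.2.trans (exchangeChain_mono (Set.subset_univ _) (hH.chain C hC.1 B hB ⟨b, hbC, hb⟩))

/-- Deleting `i` leaves a nonempty induced hypergraph, by transversal-freeness. By minimality one of
its hyperedges `T` is a transversal of it, so a hyperedge that misses `T` must have been destroyed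
by the deletion. -/
theorem exists_forall_disjoint_mem (hm : MinimalTransversalFree H) (hne : H.Nonempty) (i : V) :
    ∃ T ∈ H, ∀ A ∈ H, Disjoint A T → i ∈ A := by
  have hind : (induced H {i}ᶜ).Nonempty := by
    obtain ⟨A, hA⟩ := hne
    by_cases hi : i ∈ A
    · have := hm.1 A hA
      simp only [IsTransversal, not_forall, Set.not_nonempty_iff_eq_empty] at this
      obtain ⟨B, hB, hAB⟩ := this
      exact ⟨B, hB, fun v hv (hvi : v = i) =>
        Set.notMem_empty v (hAB ▸ ⟨hvi ▸ hi, hv⟩)⟩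
    · exact ⟨A, hA, fun v hv (hvi : v = i) => hi (hvi ▸ hv)⟩
  have := hm.2 {i}ᶜ (fun h => (h ▸ Set.mem_univ i : i ∈ ({i}ᶜ : Set V)) rfl) hind
  simp only [TransversalFree, not_forall, not_not] at this
  obtain ⟨T, ⟨hT, -⟩, htr⟩ := this
  refine ⟨T, hT, fun A hA hd => ?_⟩
  by_contra hi
  obtain ⟨v, hvT, hvA⟩ := htr A ⟨hA, fun v hv (hvi : v = i) => hi (hvi ▸ hv)⟩
  exact Set.disjoint_left.1 hd hvA hvT

variable [Finite V]

theorem exists_move_height_eq (hne : ∀ A ∈ H, A.Nonempty) {x p : V → ℕ} {A : Set V} (hA : A ∈ H)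
    (hlt : ∀ v ∈ A, p v < x v) (heq : ∀ v ∉ A, p v = x v) {z : ℕ}
    (h1 : height H (zeroOn A x) ≤ z) (h2 : z ≤ height H p) :
    ∃ q, Move H x q ∧ q ≤ p ∧ height H q = z := by
  obtain ⟨q, hq, hqp, hz⟩ := exists_height_eq hne (q := zeroOn A x) (p := p) (fun v => by
    by_cases h : v ∈ A <;> simp [zeroOn, h, heq]) h1 h2
  refine ⟨q, move_of_eq hA (hne A hA) (fun v hv => (hqp v).trans_lt (hlt v hv)) (fun v hv => ?_),
    hqp, hz⟩
  refine le_antisymm ((hqp v).trans_eq (heq v hv)) ?_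
  have := hq v
  simpa [zeroOn, hv] using this

/-- Emptying all of a hyperedge of the chain gives one height; the heights between two consecutive
ones are filled by moves in the later hyperedge that empty its overlap with the earlier one. -/
theorem HasExchange.exists_move_of_chain (hH : HasExchange H) {x : V → ℕ} {S : Set V}
    (hS : ∀ v ∈ S, 0 < x v) {A B : Set V} (hA : A ∈ H) (hAS : A ⊆ S)
    (h : Relation.ReflTransGen (ExchangeStep H S) A B) {z : ℕ}
    (h1 : height H (zeroOn B x) ≤ z) (h2 : z ≤ height H (zeroOn A x)) :
    ∃ q, Move H x q ∧ (∃ i, q i = 0) ∧ height H q = z := by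
  induction h generalizing z with
  | refl =>
    obtain ⟨a, ha⟩ := hH.nonempty A hA
    refine ⟨zeroOn A x, move_of_eq hA ⟨a, ha⟩ (fun v hv => ?_) (fun v hv => ?_), ⟨a, ?_⟩,
      le_antisymm h1 h2⟩
    · simpa [zeroOn, hv] using hS v (hAS hv)
    · simp [zeroOn, hv]
    · simp [zeroOn, ha]
  | @tail B C _ hBC ih =>
    obtain ⟨hC, hCS, c, hc⟩ := hBC
    by_cases hz : height H (zeroOn B x) ≤ z
    · exact ih hz h2
    push Not at hz
    classical
    -- The gentlest move in `C` that empties `C ∩ B`: outside `B` only pile `c` can change, by one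
    -- stone. So its height is at least that of `zeroOn B x` minus one, which leaves no gap.
    let p : V → ℕ := fun v => if v ∈ C then (if v ∈ B then 0 else x v - 1) else x v
    have hp : height H (zeroOn B x) ≤ height H p + 1 := by
      refine (height_le_update_pred hH.nonempty _ c).trans (Nat.succ_le_succ
        (height_mono hH.nonempty fun v => ?_))
      by_cases hv : v = c
      · subst hv
        rw [Function.update_self]
        by_cases h1 : v ∈ C <;> by_cases h2 : v ∈ B <;> simp [p, zeroOn, h1, h2]
      · rw [Function.update_of_ne hv]
        by_cases h2 : v ∈ B
        · simp [zeroOn, h2]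
        · have h1 : v ∉ C := fun h1 => (hc h1).elim hv h2
          simp [p, zeroOn, h1, h2]
    obtain ⟨q, hq, hqp, hqz⟩ := exists_move_height_eq hH.nonempty (x := x) (p := p) hC
      (fun v hv => by
        have := hS v (hCS hv)
        simp only [p, hv, if_true]
        split_ifs <;> omega)
      (fun v hv => by simp [p, hv]) h1 (by omega : z ≤ height H p)
    obtain ⟨v, hv, hvc⟩ := (hH.nontrivial C hC).exists_ne c
    refine ⟨q, hq, ⟨v, ?_⟩, hqz⟩
    have hvB : v ∈ B := (hc hv).resolve_left hvc
    have := hqp v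
    simp only [p, hv, hvB, if_true] at this
    omega

/-- If some pile is empty then a move can reach every smaller height. -/
theorem HasExchange.exists_move_of_zero (hH : HasExchange H) (hm : MinimalTransversalFree H)
    {x : V → ℕ} {i : V} (hi : x i = 0) {z : ℕ} (hz : z < height H x) :
    ∃ q, Move H x q ∧ height H q = z := by
  obtain ⟨Q, hQ, hc⟩ := exists_packing_height hH.nonempty x
  obtain ⟨A, hA⟩ := Multiset.card_pos_iff_exists_mem.1 (by omega : 0 < Q.card)
  obtain ⟨hAH, hpos, hdec⟩ := exists_height_decr hH.nonempty hQ hc hA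
  let S : Set V := {v | 0 < x v}
  have hS : S ≠ Set.univ := fun h => by
    have : i ∈ S := h ▸ Set.mem_univ i
    simp [S, hi] at this
  have := hm.2 S hS ⟨A, hAH, hpos⟩
  simp only [TransversalFree, not_forall, not_not] at this
  obtain ⟨T, ⟨hT, hTS⟩, htr⟩ := this
  by_cases hza : height H (zeroOn A x) ≤ z
  · obtain ⟨q, hq, -, hqz⟩ := exists_move_height_eq hH.nonempty (x := x) (p := decr A x) hAH
      (fun v hv => by have := hpos v hv; simp only [decr, hv, if_true]; omega)
      (fun v hv => by simp [decr, hv]) hza (by omega)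
    exact ⟨q, hq, hqz⟩
  -- `T` meets every hyperedge of nonempty piles, so emptying it ends the game. It also meets `A`,
  -- and both lie in the support `S`, so the chain from `A` to `T` uses nonempty piles only.
  · have h0 : height H (zeroOn T x) = 0 :=
      height_zeroOn_eq_zero hH.nonempty fun B hB hBpos => htr B ⟨hB, hBpos⟩
    obtain ⟨q, hq, -, hqz⟩ := hH.exists_move_of_chain (x := x) (S := S) (fun v hv => hv) hAH hpos
      (exchangeChain_mono (Set.union_subset hpos hTS)
        (hH.chain A hAH T hT (by rw [Set.inter_comm]; exact htr A ⟨hAH, hpos⟩))) (z := z) (by omega) (by omega)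
    exact ⟨q, hq, hqz⟩

open Classical in
/-- Moves that empty a pile reach all heights from the size of the pile `i` up to the height left
after emptying `i` and decreasing the rest of a hyperedge by one. -/
theorem HasExchange.exists_move_of_pos (hH : HasExchange H) (hm : MinimalTransversalFree H)
    {x : V → ℕ} (hx : ∀ v, 0 < x v) {A : Set V} (hA : A ∈ H) {i : V} (hi : i ∈ A) {z : ℕ}
    (h1 : x i ≤ z) (h2 : z ≤ height H (Function.update (decr A x) i 0)) :
    ∃ q, Move H x q ∧ (∃ j, q j = 0) ∧ height H q = z := by
  obtain ⟨T, hT, htr⟩ := exists_forall_disjoint_mem hm ⟨A, hA⟩ i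
  by_cases hza : height H (zeroOn A x) ≤ z
  · obtain ⟨q, hq, hqp, hqz⟩ := exists_move_height_eq hH.nonempty (x := x)
      (p := Function.update (decr A x) i 0) hA
      (fun v hv => by
        have := hx v
        by_cases hvi : v = i
        · subst hvi; simpa using this
        · rw [Function.update_of_ne hvi]
          simp only [decr, hv, if_true]; omega)
      (fun v hv => by
        rw [Function.update_of_ne (by rintro rfl; exact hv hi)]
        simp [decr, hv]) hza h2
    refine ⟨q, hq, ⟨i, ?_⟩, hqz⟩
    have := hqp i
    rw [Function.update_self] at this
    exact Nat.eq_zero_of_le_zero this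
  · exact hH.exists_move_of_chain (S := Set.univ) (fun v _ => hx v) hA (Set.subset_univ _)
      (hH.chain_univ hA hT) ((height_zeroOn_le hH.nonempty htr).trans h1) (by omega)

/-- If no pile is empty then every pile belongs to the first move of a longest play. -/
theorem HasExchange.exists_mem_height_decr (hH : HasExchange H) (hne : H.Nonempty)
    {x : V → ℕ} (hx : ∀ v, 0 < x v) (i : V) :
    ∃ A ∈ H, i ∈ A ∧ height H x ≤ height H (decr A x) + 1 := by
  -- The piles used by some largest packing.
  let C : Set V := {v | ∃ Q, IsPacking H x Q ∧ Q.card = height H x ∧ ∃ A ∈ Q, v ∈ A}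
  have hC : C = Set.univ := by
    by_contra hCu
    have hCne : C.Nonempty := by
      obtain ⟨Q, hQ, hc⟩ := exists_packing_height hH.nonempty x
      obtain ⟨B, hB⟩ := hne
      have := le_height_of_forall_le hH.nonempty hB (x := x) (d := 1) fun v _ => hx v
      obtain ⟨A, hA⟩ := Multiset.card_pos_iff_exists_mem.1 (by omega : 0 < Q.card)
      obtain ⟨a, ha⟩ := hH.nonempty A (hQ.1 A hA)
      exact ⟨a, Q, hQ, hc, A, hA, ha⟩
    obtain ⟨a, ⟨Q, hQ, hcard, A, hA, haA⟩, c, hc, h⟩ := hH.attach C hCne hCu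
    have hcQ : ∀ B ∈ Q, c ∉ B := fun B hB hcB => hc ⟨Q, hQ, hcard, B, hB, hcB⟩
    obtain ⟨B, hB, hcB, hsub⟩ := h A (hQ.1 A hA) haA
    obtain ⟨Q, rfl⟩ := Multiset.exists_cons_of_mem hA
    -- Replacing `A` by `B` keeps the packing and its size: the only new pile `c` is nonempty and
    -- was not covered at all.
    refine hc ⟨B ::ₘ Q, ⟨fun D hD => ?_, fun v => ?_⟩, by simpa using hcard, B,
      Multiset.mem_cons_self B Q, hcB⟩
    · rcases Multiset.mem_cons.1 hD with rfl | hD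
      · exact hB
      · exact hQ.of_cons.1 D hD
    · by_cases hvB : v ∈ B
      · rw [cover_cons_of_mem hvB]
        rcases hsub hvB with rfl | hvA
        · rw [cover_eq_zero fun D hD => hcQ D (Multiset.mem_cons_of_mem hD)]
          exact hx v
        · rw [← cover_cons_of_mem hvA]
          exact hQ.2 v
      · rw [cover_cons_of_notMem hvB]
        exact hQ.of_cons.2 v
  obtain ⟨Q, hQ, hc, A, hA, hi⟩ : i ∈ C := hC ▸ Set.mem_univ i
  obtain ⟨hAH, -, hdec⟩ := exists_height_decr hH.nonempty hQ hc hA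
  exact ⟨A, hAH, hi, hdec⟩

end Moves

/-! ### Arithmetic of the formula and the Sprague–Grundy recursion -/

theorem choose_two_succ (n : ℕ) : (n + 1).choose 2 = n.choose 2 + n := by
  rw [Nat.choose_succ_succ' n 1, Nat.choose_one_right, add_comm]

theorem exists_choose_two_le_lt (z : ℕ) :
    ∃ n, 1 ≤ n ∧ n.choose 2 ≤ z ∧ z < n.choose 2 + n := by
  have hex : ∃ n, z < (n + 1).choose 2 := ⟨z + 1, by
    rw [choose_two_succ]; omega⟩
  classical
  have h1 := Nat.find_spec hex
  have h0 : Nat.find hex ≠ 0 := fun h => by simp [h] at h1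
  refine ⟨Nat.find hex, by omega, ?_, by rwa [← choose_two_succ]⟩
  have := Nat.find_min hex (m := Nat.find hex - 1) (by omega)
  rw [Nat.sub_add_cancel (by omega)] at this
  omega

/-- The arithmetic behind the values taken by the Jenkyns–Mayberry formula. -/
theorem exists_short_target {m y z : ℕ} (hz : z < m)
    (hs : y.choose 2 < m → z < y.choose 2 + (m - y.choose 2 - 1) % y) (hy : 1 ≤ y) :
    ∃ η m', 1 ≤ η ∧ η ≤ y ∧ m' ≤ m ∧ m - m' + 1 ≤ η ∧ (m' = m → η < y) ∧
      η.choose 2 < m' ∧ η.choose 2 + (m' - η.choose 2 - 1) % η = z := by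
  -- The blocks `[C(η, 2), C(η, 2) + η)` partition the natural numbers, so `z` determines `η`.
  obtain ⟨η, h1, h2, h3⟩ := exists_choose_two_le_lt z
  have hηy : η ≤ y := by
    by_contra h
    have hc := Nat.choose_le_choose 2 (Nat.succ_le_of_lt (not_le.1 h))
    rw [Nat.succ_eq_add_one, choose_two_succ] at hc
    by_cases hm : y.choose 2 < m
    · have := hs hm
      have := Nat.mod_lt (m - y.choose 2 - 1) hy
      omega
    · omega
  have hlt := Nat.mod_lt (m - 1 - z) h1
  have hle := Nat.mod_le (m - 1 - z) η
  have hdm := Nat.mod_add_div (m - 1 - z) η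
  have hval : η.choose 2 + (m - (m - 1 - z) % η - η.choose 2 - 1) % η = z := by
    have : m - (m - 1 - z) % η - η.choose 2 - 1 =
        (z - η.choose 2) + η * ((m - 1 - z) / η) := by omega
    rw [this, Nat.add_mul_mod_self_left, Nat.mod_eq_of_lt (by omega)]
    omega
  -- `m'` is the largest number up to `m` congruent to `z + 1` modulo `η`. If `m' = m` and `η = y`,
  -- then `z` would be the value excluded by `hs`.
  refine ⟨η, m - (m - 1 - z) % η, h1, hηy, by omega, by omega, fun h => ?_, by omega, hval⟩
  refine lt_of_le_of_ne hηy fun h' => ?_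
  rw [h, h'] at hval
  have := hs (by rw [← h']; omega)
  omega

theorem mex_eq_iff {S : Set ℕ} {n : ℕ} (h1 : n ∉ S) (h2 : ∀ k < n, k ∈ S) : mex S = n := by
  refine le_antisymm (Nat.sInf_le h1) ?_
  by_contra h
  push Not at h
  exact Nat.sInf_mem (s := {n | n ∉ S}) ⟨n, h1⟩ (h2 _ h)

/-- A function that obeys the recursion of the Sprague–Grundy function equals it. -/
theorem spragueGrundy_eq_of_forall {V : Type*} [Finite V] {H : Set (Set V)} {g : (V → ℕ) → ℕ}
    (h1 : ∀ x q, Move H x q → g q ≠ g x)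
    (h2 : ∀ x, ∀ z < g x, ∃ q, Move H x q ∧ g q = z) (x : V → ℕ) :
    spragueGrundy H x = g x := by
  induction x using (wellFounded_lt (α := V → ℕ)).induction with
  | _ x ih =>
    rw [spragueGrundy]
    refine mex_eq_iff ?_ fun z hz => ?_
    · rintro ⟨⟨q, hq⟩, h⟩
      exact h1 x q hq (by rw [← h]; exact (ih q hq.1).symm)
    · obtain ⟨q, hq, hz⟩ := h2 x z hz
      exact ⟨⟨q, hq⟩, by rw [← hz]; exact ih q hq.1⟩

/-! ### The Jenkyns–Mayberry formula obeys the recursion -/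

section Formula

variable {V : Type*} {H : Set (Set V)}

theorem minPile_le (x : V → ℕ) (v : V) : minPile x ≤ x v :=
  ciInf_le' x v

theorem exists_eq_minPile [Nonempty V] (x : V → ℕ) : ∃ i, x i = minPile x :=
  ciInf_mem x

theorem minPile_eq {x : V → ℕ} {m : ℕ} {i : V} (hi : x i = m) (h : ∀ v, m ≤ x v) :
    minPile x = m := by
  have : Nonempty V := ⟨i⟩
  exact le_antisymm (hi ▸ minPile_le x i) (le_ciInf h)

theorem Move.add_const {x q : V → ℕ} (h : Move H x q) (d : ℕ) :
    Move H (fun v => x v + d) (fun v => q v + d) := by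
  refine move_of_eq h.2 ?_ (fun v hv => ?_) (fun v hv => ?_)
  · obtain ⟨-, v, hv⟩ := Pi.lt_def.1 h.1
    exact ⟨v, hv⟩
  · exact Nat.add_lt_add_right hv d
  · have h1 : q v ≤ x v := h.1.le v
    have h2 : ¬q v < x v := hv
    change q v + d = x v + d
    omega

theorem Move.sub_const {x q : V → ℕ} (h : Move H x q) {d : ℕ} (hd : ∀ v, d ≤ q v) :
    Move H (fun v => x v - d) (fun v => q v - d) := by
  refine move_of_eq h.2 ?_ (fun v hv => ?_) (fun v hv => ?_)
  · obtain ⟨-, v, hv⟩ := Pi.lt_def.1 h.1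
    exact ⟨v, hv⟩
  · have := hd v
    have h2 : q v < x v := hv
    change q v - d < x v - d
    omega
  · have h1 : q v ≤ x v := h.1.le v
    have h2 : ¬q v < x v := hv
    change q v - d = x v - d
    omega

theorem vValue_lt (x : V → ℕ) (h : (yValue H x).choose 2 < minPile x) :
    vValue H x < minPile x := by
  have := Nat.mod_le (minPile x - (yValue H x).choose 2 - 1) (yValue H x)
  unfold vValue
  omega

theorem exists_disjoint_of_transversalFree (hm : TransversalFree H) {A : Set V} (hA : A ∈ H) :
    ∃ B ∈ H, Disjoint A B := by
  have := hm A hA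
  simp only [IsTransversal, not_forall, Set.not_nonempty_iff_eq_empty] at this
  obtain ⟨B, hB, hAB⟩ := this
  exact ⟨B, hB, Set.disjoint_iff_inter_eq_empty.2 hAB⟩

theorem Move.exists_eq_on (hm : TransversalFree H) {x q : V → ℕ} (h : Move H x q) :
    ∃ B ∈ H, ∀ v ∈ B, q v = x v := by
  obtain ⟨B, hB, hd⟩ := exists_disjoint_of_transversalFree hm h.2
  refine ⟨B, hB, fun v hv => le_antisymm (h.1.le v) ?_⟩
  by_contra hlt
  exact Set.disjoint_left.1 hd (by simpa using hlt : v ∈ {i | q i < x i}) hv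

variable [Finite V]

/-- Between long positions the height drops. If exactly one position is short, its value is below
its smallest pile, which is at most `height H q` because the piles of `B` are unchanged. The case of
two short positions is a congruence argument modulo the common `y`. -/
theorem jmFormula_ne_of_move (hne : ∀ A ∈ H, A.Nonempty) (hm : TransversalFree H)
    {x q : V → ℕ} (h : Move H x q) : jmFormula H q ≠ jmFormula H x := by
  obtain ⟨B, hB, hBq⟩ := h.exists_eq_on hm
  have hlt := height_lt_of_move hne h
  have hmq : minPile q ≤ height H q := le_height_of_forall_le hne hB fun v _ => minPile_le q v
  have hmx : minPile x ≤ height H q :=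
    le_height_of_forall_le hne hB fun v hv => hBq v hv ▸ minPile_le x v
  unfold jmFormula
  split_ifs with h1 h2 h2
  · exact hlt.ne
  · have := vValue_lt x (not_le.1 h2)
    omega
  · have := vValue_lt q (not_le.1 h1)
    omega
  · intro heq
    push Not at h1 h2
    obtain ⟨b, -⟩ := hne B hB
    have : Nonempty V := ⟨b⟩
    have hle : minPile q ≤ minPile x := by
      obtain ⟨i, hi⟩ := exists_eq_minPile x
      exact (minPile_le q i).trans (hi ▸ h.1.le i)
    have hyq : 0 < yValue H q := Nat.succ_pos _
    have hyx : 0 < yValue H x := Nat.succ_pos _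
    have hmodq := Nat.mod_lt (minPile q - (yValue H q).choose 2 - 1) hyq
    have hmodx := Nat.mod_lt (minPile x - (yValue H x).choose 2 - 1) hyx
    unfold vValue at heq
    -- The value of a short position lies in the block `[C(y, 2), C(y, 2) + y)`, and distinct blocks
    -- are disjoint.
    have hy : yValue H q = yValue H x := by
      rcases lt_trichotomy (yValue H q) (yValue H x) with hl | he | hl
      · have := Nat.choose_le_choose 2 (Nat.succ_le_of_lt hl)
        rw [Nat.succ_eq_add_one, choose_two_succ] at this
        omega
      · exact he
      · have := Nat.choose_le_choose 2 (Nat.succ_le_of_lt hl)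
        rw [Nat.succ_eq_add_one, choose_two_succ] at this
        omega
    rcases hle.eq_or_lt with he | hl
    · have := height_lt_of_move hne (h.sub_const (d := minPile q) fun v => minPile_le q v)
      unfold yValue at hy
      rw [← he] at hy
      omega
    -- Equal values make `m(x) - m(q)` a positive multiple of `y`. But the piles of `B` exceed
    -- `m(q)` by at least that much, which forces `y(q) > m(x) - m(q)`.
    · rw [hy] at heq h1
      have hmod : (minPile q - (yValue H x).choose 2 - 1) ≡
          (minPile x - (yValue H x).choose 2 - 1) [MOD yValue H x] := by
        unfold Nat.ModEq
        omega
      have hdvd := (Nat.modEq_iff_dvd' (by omega)).1 hmod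
      have hyle := Nat.le_of_dvd (by omega) hdvd
      have : minPile x - minPile q ≤ height H (fun v => q v - minPile q) :=
        le_height_of_forall_le hne hB fun v hv =>
          Nat.sub_le_sub_right (hBq v hv ▸ minPile_le x v) _
      have : yValue H q = height H (fun v => q v - minPile q) + 1 := rfl
      omega

/-- The pairs `(m, y)` that a move can reach. -/
theorem HasExchange.exists_move_minPile_yValue (hH : HasExchange H)
    (hm : MinimalTransversalFree H) (hne : H.Nonempty) {x : V → ℕ} {η m' : ℕ} (h1 : 1 ≤ η)
    (hηy : η ≤ yValue H x) (hm' : m' ≤ minPile x) (hη : minPile x - m' + 1 ≤ η)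
    (hlt : m' = minPile x → η < yValue H x) :
    ∃ q, Move H x q ∧ minPile q = m' ∧ yValue H q = η := by
  have : Nonempty V := by
    obtain ⟨A, hA⟩ := hne
    exact (hH.nonempty A hA).to_type
  obtain ⟨i, hi⟩ := exists_eq_minPile x
  -- Take `m'` stones off every pile: the target is then a position with an empty pile and height `η
  -- - 1`.
  suffices ∃ q, Move H (fun v => x v - m') q ∧ (∃ j, q j = 0) ∧ height H q = η - 1 by
    obtain ⟨q, hq, ⟨j, hj⟩, hqη⟩ := this
    have hmin : minPile (fun v => q v + m') = m' := minPile_eq (i := j) (by simp [hj]) (by simp)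
    refine ⟨fun v => q v + m', ?_, hmin, ?_⟩
    · have hx : x = fun v => x v - m' + m' := funext fun v =>
        (Nat.sub_add_cancel (hm'.trans (minPile_le x v))).symm
      rw [hx]
      exact hq.add_const m'
    · unfold yValue
      rw [hmin]
      simp only [Nat.add_sub_cancel]
      change height H q + 1 = η
      omega
  have hy : yValue H x = height H (fun v => x v - minPile x) + 1 := rfl
  rcases hm'.eq_or_lt with rfl | hl
  · have := hlt rfl
    have hi0 : (fun v => x v - minPile x) i = 0 := by simp [hi]
    obtain ⟨q, hq, hqz⟩ := hH.exists_move_of_zero hm (x := fun v => x v - minPile x) hi0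
      (z := η - 1) (by omega)
    exact ⟨q, hq, ⟨i, Nat.eq_zero_of_le_zero ((hq.1.le i).trans_eq hi0)⟩, hqz⟩
  · have hpos : ∀ v, 0 < x v - m' := fun v => by
      have := minPile_le x v
      omega
    obtain ⟨A, hA, hiA, -⟩ := hH.exists_mem_height_decr hne hpos i
    classical
    have hiη : x i - m' ≤ η - 1 := by omega
    refine hH.exists_move_of_pos hm hpos hA hiA hiη ?_
    refine (by omega : η - 1 ≤ height H (fun v => x v - minPile x)).trans
      (height_mono hH.nonempty fun v => ?_)
    by_cases hv : v = i
    · subst hv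
      simp [hi]
    · rw [Function.update_of_ne hv]
      simp only [decr]
      split_ifs <;> omega

/-- From a long position all heights from the minimal pile size on are reached at long
positions. -/
theorem HasExchange.exists_move_long (hH : HasExchange H) (hm : MinimalTransversalFree H)
    (hne : H.Nonempty) {x : V → ℕ} (hx : minPile x ≤ (yValue H x).choose 2) {z : ℕ}
    (h1 : minPile x ≤ z) (h2 : z < height H x) :
    ∃ q, Move H x q ∧ minPile q ≤ (yValue H q).choose 2 ∧ height H q = z := by
  have : Nonempty V := by
    obtain ⟨A, hA⟩ := hne
    exact (hH.nonempty A hA).to_type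
  obtain ⟨i, hi⟩ := exists_eq_minPile x
  have hzero : ∀ q : V → ℕ, (∃ j, q j = 0) → minPile q ≤ (yValue H q).choose 2 := by
    rintro q ⟨j, hj⟩
    rw [minPile_eq hj fun _ => Nat.zero_le _]
    exact Nat.zero_le _
  rcases Nat.eq_zero_or_pos (minPile x) with h0 | hpos
  · obtain ⟨q, hq, hqz⟩ := hH.exists_move_of_zero hm (hi.trans h0) h2
    exact ⟨q, hq, hzero q ⟨i, Nat.eq_zero_of_le_zero ((hq.1.le i).trans_eq (hi.trans h0))⟩, hqz⟩
  have hxpos : ∀ v, 0 < x v := fun v => hpos.trans_le (minPile_le x v)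
  obtain ⟨A, hA, hiA, hdec⟩ := hH.exists_mem_height_decr hne hxpos i
  classical
  by_cases hz : z ≤ height H (Function.update (decr A x) i 0)
  · obtain ⟨q, hq, hq0, hqz⟩ := hH.exists_move_of_pos hm hxpos hA hiA (hi ▸ h1) hz
    exact ⟨q, hq, hzero q hq0, hqz⟩
  -- The remaining heights are reached by varying pile `i` alone, the rest of `A` being decreased by
  -- one.
  obtain ⟨q, hq1, hq2, hqz⟩ := exists_height_eq hH.nonempty
    (q := Function.update (decr A x) i 0) (p := decr A x)
    ((update_le_self_iff).2 (Nat.zero_le _)) (z := z) (by omega) (by omega)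
  have hmq : minPile q ≤ minPile x - 1 := by
    refine (minPile_le q i).trans ((hq2 i).trans ?_)
    simp [decr, hiA, hi]
  have hge : ∀ v, v ≠ i → decr A x v ≤ q v := fun v hv => by
    have := hq1 v
    rwa [Function.update_of_ne hv] at this
  refine ⟨q, move_of_eq hA ⟨i, hiA⟩ (fun v hv => ?_) (fun v hv => ?_), ?_, hqz⟩
  · have h3 := hq2 v
    have h4 := hxpos v
    simp only [decr, hv, if_true] at h3
    omega
  · have h3 := hq2 v
    have h4 := hge v (by rintro rfl; exact hv hiA)
    simp only [decr, hv, if_false] at h3 h4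
    omega
  -- The smallest pile drops by at least one and the piles other than `i` by at most one, so `q -
  -- m(q)e ≥ x - m(x)e`. Hence `y` does not decrease and `q` is long.
  · refine (hmq.trans (Nat.sub_le _ _)).trans (hx.trans (Nat.choose_le_choose 2 ?_))
    refine Nat.succ_le_succ (height_mono hH.nonempty fun v => ?_)
    by_cases hv : v = i
    · subst hv
      simp [hi]
    · have h3 := hge v hv
      unfold decr at h3
      split_ifs at h3 <;> simp only <;> omega

theorem isJM_empty : IsJM (∅ : Set (Set V)) := by
  have hh : ∀ x : V → ℕ, height ∅ x = 0 := fun x => by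
    obtain ⟨Q, hQ, hc⟩ := exists_packing_height (H := (∅ : Set (Set V))) (by simp) x
    rw [← hc, Multiset.card_eq_zero, Multiset.eq_zero_iff_forall_notMem]
    exact fun A hA => hQ.1 A hA
  refine spragueGrundy_eq_of_forall (fun x q h => absurd h.2 (Set.notMem_empty _)) ?_
  intro x z hz
  simp [jmFormula, vValue, yValue, hh, Nat.mod_one] at hz

/-- A minimal transversal-free hypergraph with the exchange property is JM. -/
theorem HasExchange.isJM (hH : HasExchange H) (hm : MinimalTransversalFree H) : IsJM H := by
  rcases H.eq_empty_or_nonempty with rfl | hne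
  · exact isJM_empty
  refine spragueGrundy_eq_of_forall (fun x q h => jmFormula_ne_of_move hH.nonempty hm.1 h) ?_
  intro x z hz
  by_cases hlong : minPile x ≤ (yValue H x).choose 2 ∧ minPile x ≤ z
  · rw [jmFormula, if_pos hlong.1] at hz
    obtain ⟨q, hq, hq1, hqz⟩ := hH.exists_move_long hm hne hlong.1 hlong.2 hz
    exact ⟨q, hq, by rw [jmFormula, if_pos hq1, hqz]⟩
  · have hs : (yValue H x).choose 2 < minPile x → z < vValue H x := fun h => by
      rwa [jmFormula, if_neg (not_le.2 h)] at hz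
    have hzm : z < minPile x := by
      by_cases h : minPile x ≤ (yValue H x).choose 2
      · exact not_le.1 fun h' => hlong ⟨h, h'⟩
      · exact (hs (not_le.1 h)).trans (vValue_lt x (not_le.1 h))
    obtain ⟨η, m', h1, h2, h3, h4, h5, h6, h7⟩ :=
      exists_short_target hzm hs (Nat.succ_pos _)
    obtain ⟨q, hq, hqm, hqy⟩ := hH.exists_move_minPile_yValue hm hne h1 h2 h3 h4 h5
    refine ⟨q, hq, ?_⟩
    rw [jmFormula, if_neg (by rw [hqm, hqy]; omega), vValue, hqm, hqy, h7]

end Formula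

/-! ### Exchanges between connected edge sets and between trees -/

section Edges

variable {U : Type*} {G : SimpleGraph U}

/-- Two edges share a vertex. -/
def Touch (e f : G.edgeSet) : Prop :=
  ∃ v, v ∈ e.1 ∧ v ∈ f.1

/-- A nonempty set of edges that is connected through shared vertices. -/
def LineConnected (F : Set G.edgeSet) : Prop :=
  F.Nonempty ∧ ∀ C, C ⊂ F → C.Nonempty → ∃ c ∈ C, ∃ e ∈ F, e ∉ C ∧ Touch c e

/-- A connected set of edges, which if `t` holds has the number of vertices of a tree. -/
def IsGood (t : Prop) (F : Set G.edgeSet) : Prop :=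
  LineConnected F ∧ (t → (supportingVertices G F).ncard = F.ncard + 1)

/-- The good sets of `k` edges. -/
def goodFamily (G : SimpleGraph U) (t : Prop) (k : ℕ) : Set (Set G.edgeSet) :=
  {F | F.ncard = k ∧ IsGood t F}

/-- An exchange that brings in at most one edge, which shares a vertex with the old set. -/
def EdgeStep (H : Set (Set G.edgeSet)) (S A B : Set G.edgeSet) : Prop :=
  B ∈ H ∧ B ⊆ S ∧ ∃ c, B ⊆ insert c A ∧ ∃ a ∈ A, Touch a c

theorem exists_eq_of_mem (e : G.edgeSet) {v : U} (hv : v ∈ e.1) :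
    ∃ w, e.1 = s(v, w) ∧ G.Adj v w := by
  obtain ⟨w, hw⟩ := hv
  exact ⟨w, hw, by have := e.2; rwa [hw, SimpleGraph.mem_edgeSet] at this⟩

theorem exists_mem_edge (e : G.edgeSet) : ∃ v, v ∈ e.1 := by
  obtain ⟨e, he⟩ := e
  induction e using Sym2.ind with
  | _ a b => exact ⟨a, Sym2.mem_mk_left a b⟩

theorem Touch.refl (e : G.edgeSet) : Touch e e := by
  obtain ⟨v, hv⟩ := exists_mem_edge e
  exact ⟨v, hv, hv⟩

theorem Touch.symm {e f : G.edgeSet} (h : Touch e f) : Touch f e := by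
  obtain ⟨v, h1, h2⟩ := h
  exact ⟨v, h2, h1⟩

theorem edgeGraph_adj {F : Set G.edgeSet} {v w : U} :
    (edgeGraph G F).Adj v w ↔ ∃ e ∈ F, e.1 = s(v, w) := by
  rw [edgeGraph, SimpleGraph.fromEdgeSet_adj]
  constructor
  · rintro ⟨⟨e, he, h⟩, -⟩
    exact ⟨e, he, h⟩
  · rintro ⟨e, he, h⟩
    have := e.2
    rw [h, SimpleGraph.mem_edgeSet] at this
    exact ⟨⟨e, he, h⟩, this.ne⟩

theorem mem_supportingVertices {F : Set G.edgeSet} {v : U} :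
    v ∈ supportingVertices G F ↔ ∃ e ∈ F, v ∈ e.1 := by
  rw [supportingVertices, SimpleGraph.mem_support]
  constructor
  · rintro ⟨w, h⟩
    obtain ⟨e, he, h⟩ := edgeGraph_adj.1 h
    exact ⟨e, he, h ▸ Sym2.mem_mk_left v w⟩
  · rintro ⟨e, he, hv⟩
    obtain ⟨w, hw, -⟩ := exists_eq_of_mem e hv
    exact ⟨w, edgeGraph_adj.2 ⟨e, he, hw⟩⟩

theorem supportingVertices_mono {C F : Set G.edgeSet} (h : C ⊆ F) :
    supportingVertices G C ⊆ supportingVertices G F := fun v hv => by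
  obtain ⟨e, he, hv⟩ := mem_supportingVertices.1 hv
  exact mem_supportingVertices.2 ⟨e, h he, hv⟩

theorem supportingVertices_insert {F : Set G.edgeSet} {c e : G.edgeSet} {v w : U} (hc : c ∈ F)
    (hv : v ∈ c.1) (he : e.1 = s(v, w)) :
    supportingVertices G (insert e F) = insert w (supportingVertices G F) := by
  ext u
  simp only [mem_supportingVertices, Set.mem_insert_iff]
  constructor
  · rintro ⟨f, rfl | hf, hu⟩
    · rw [he, Sym2.mem_iff] at hu
      rcases hu with rfl | rfl
      · exact Or.inr ⟨c, hc, hv⟩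
      · exact Or.inl rfl
    · exact Or.inr ⟨f, hf, hu⟩
  · rintro (rfl | ⟨f, hf, hu⟩)
    · exact ⟨e, Or.inl rfl, he ▸ Sym2.mem_mk_right v u⟩
    · exact ⟨f, Or.inr hf, hu⟩

/-- This is why `EdgeStep` asks the new edge to touch the old set: an edge exchange then brings in
at most one vertex, hence is also an exchange of vertex sets. -/
theorem exists_supportingVertices_insert_eq {A : Set G.edgeSet} {a c : G.edgeSet}
    (ha : a ∈ A) (hac : Touch a c) :
    ∃ w, supportingVertices G (insert c A) = insert w (supportingVertices G A) := by
  obtain ⟨v, hva, hvc⟩ := hac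
  obtain ⟨w, hw, -⟩ := exists_eq_of_mem c hvc
  exact ⟨w, supportingVertices_insert ha hva hw⟩

theorem LineConnected.insert_of_touch {C : Set G.edgeSet} (h : LineConnected C) {c e : G.edgeSet}
    (hc : c ∈ C) (hce : Touch c e) : LineConnected (insert e C) := by
  refine ⟨Set.insert_nonempty e C, fun D hD hne => ?_⟩
  by_cases he : e ∈ D
  · by_cases hDC : (D ∩ C).Nonempty
    · obtain ⟨x, hx, hxD⟩ := Set.exists_of_ssubset hD
      have hlt : D ∩ C ⊂ C := by
        refine (Set.ssubset_iff_of_subset Set.inter_subset_right).2 ⟨x, ?_, fun h => hxD h.1⟩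
        exact hx.resolve_left fun h => hxD (h ▸ he)
      obtain ⟨a, ha, b, hb, hbn, hab⟩ := h.2 _ hlt hDC
      exact ⟨a, ha.1, b, Or.inr hb, fun h => hbn ⟨h, hb⟩, hab⟩
    · exact ⟨e, he, c, Or.inr hc, fun h => hDC ⟨c, h, hc⟩, hce.symm⟩
  · have hsub : D ⊆ C := fun x hx => (hD.1 hx).resolve_left fun h => he (h ▸ hx)
    rcases hsub.eq_or_ssubset with rfl | hlt
    · exact ⟨c, hc, e, Or.inl rfl, he, hce⟩
    · obtain ⟨a, ha, b, hb, hbn, hab⟩ := h.2 _ hlt hne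
      exact ⟨a, ha, b, Or.inr hb, hbn, hab⟩

theorem lineConnected_singleton (e : G.edgeSet) : LineConnected ({e} : Set G.edgeSet) :=
  ⟨Set.singleton_nonempty e, fun _ hC hne =>
    absurd (Set.ssubset_singleton_iff.1 hC) hne.ne_empty⟩

theorem isGood_singleton (t : Prop) (e : G.edgeSet) : IsGood t ({e} : Set G.edgeSet) := by
  refine ⟨lineConnected_singleton e, fun _ => ?_⟩
  obtain ⟨v, hv⟩ := exists_mem_edge e
  obtain ⟨w, hw, hadj⟩ := exists_eq_of_mem e hv
  have : supportingVertices G {e} = {v, w} := by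
    ext u
    simp [mem_supportingVertices, hw]
  rw [this, Set.ncard_pair hadj.ne, Set.ncard_singleton]

variable [Finite U]

theorem IsGood.insert_of_touch {t : Prop} {D : Set G.edgeSet} (h : IsGood t D) {c e : G.edgeSet}
    (hc : c ∈ D) (he : e ∉ D) (hce : Touch c e)
    (hw : t → ∃ w ∈ e.1, w ∉ supportingVertices G D) : IsGood t (insert e D) := by
  refine ⟨h.1.insert_of_touch hc hce, fun ht => ?_⟩
  obtain ⟨v, hvc, hve⟩ := hce
  obtain ⟨w, hw, hwD⟩ := hw ht
  obtain ⟨w', hvw, -⟩ := exists_eq_of_mem e hve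
  rw [hvw, Sym2.mem_iff] at hw
  have hww : w = w' := hw.resolve_left fun h =>
    hwD (h ▸ mem_supportingVertices.2 ⟨c, hc, hvc⟩)
  subst hww
  rw [supportingVertices_insert hc hvc hvw, Set.ncard_insert_of_notMem hwD,
    Set.ncard_insert_of_notMem he, h.2 ht]

theorem isGood_pair (t : Prop) {e f : G.edgeSet} (hne : e ≠ f) (h : Touch e f) :
    IsGood t ({f, e} : Set G.edgeSet) := by
  refine (isGood_singleton t e).insert_of_touch rfl (fun h => hne h.symm) h fun _ => ?_
  obtain ⟨v, hve, hvf⟩ := h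
  obtain ⟨w, hw, hadj⟩ := exists_eq_of_mem f hvf
  refine ⟨w, hw ▸ Sym2.mem_mk_right v w, fun hwe => hne (Subtype.ext ?_)⟩
  obtain ⟨e', he', hwe⟩ := mem_supportingVertices.1 hwe
  rw [Set.mem_singleton_iff.1 he'] at hwe
  rw [hw]
  exact (Sym2.mem_and_mem_iff hadj.ne).1 ⟨hve, hwe⟩

theorem IsGood.grow {t : Prop} {D F : Set G.edgeSet} (hD : IsGood t D) (hF : LineConnected F)
    (hDF : D ⊂ F) (ht : t → D.ncard + 1 < (supportingVertices G F).ncard) :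
    ∃ e ∈ F, e ∉ D ∧ (∃ c ∈ D, Touch c e) ∧ IsGood t (insert e D) := by
  by_cases h : t
  -- The edges of `F` spanned by the vertices of the tree `D`. They miss a vertex of `F`, so
  -- connectedness of `F` gives an edge leaving `D'`; it has a vertex outside `D` and closes no
  -- cycle.
  · let D' : Set G.edgeSet := {e | e ∈ F ∧ ∀ v ∈ e.1, v ∈ supportingVertices G D}
    have hDD' : D ⊆ D' := fun e he =>
      ⟨hDF.1 he, fun v hv => mem_supportingVertices.2 ⟨e, he, hv⟩⟩
    have hlt : D' ⊂ F := by
      refine Set.ssubset_iff_subset_ne.2 ⟨fun e he => he.1, fun heq => ?_⟩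
      have hsub : supportingVertices G F ⊆ supportingVertices G D := fun v hv => by
        obtain ⟨e, he, hv⟩ := mem_supportingVertices.1 hv
        rw [← heq] at he
        exact he.2 v hv
      have h1 := Set.ncard_le_ncard hsub
      have h2 := ht h
      rw [hD.2 h] at h1
      omega
    obtain ⟨c, hc, e, he, heD', v, hvc, hve⟩ := hF.2 D' hlt (hD.1.1.mono hDD')
    obtain ⟨d, hd, hvd⟩ := mem_supportingVertices.1 (hc.2 v hvc)
    refine ⟨e, he, fun h => heD' (hDD' h), ⟨d, hd, v, hvd, hve⟩,
      hD.insert_of_touch hd (fun h => heD' (hDD' h)) ⟨v, hvd, hve⟩ fun _ => ?_⟩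
    by_contra hcon
    push Not at hcon
    exact heD' ⟨he, hcon⟩
  · obtain ⟨c, hc, e, he, heD, hce⟩ := hF.2 D hDF hD.1.1
    exact ⟨e, he, heD, ⟨c, hc, hce⟩, hD.insert_of_touch hc heD hce fun ht => absurd ht h⟩

theorem IsGood.extend {t : Prop} {F : Set G.edgeSet} (hF : LineConnected F) {k : ℕ}
    (hkF : k ≤ F.ncard) (ht : t → k + 1 ≤ (supportingVertices G F).ncard) (n : ℕ) :
    ∀ D : Set G.edgeSet, IsGood t D → D ⊆ F → D.ncard + n = k →
      ∃ D' ∈ goodFamily G t k, D ⊆ D' ∧ D' ⊆ F := by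
  induction n with
  | zero => exact fun D hD hDF hn => ⟨D, ⟨hn, hD⟩, le_rfl, hDF⟩
  | succ n ih =>
    intro D hD hDF hn
    have hlt : D ⊂ F := Set.ssubset_iff_subset_ne.2 ⟨hDF, by rintro rfl; omega⟩
    obtain ⟨e, he, heD, -, hg⟩ := hD.grow hF hlt fun h => by
      have := ht h
      omega
    obtain ⟨D', hD', h1, h2⟩ := ih _ hg (Set.insert_subset he hDF) (by
      rw [Set.ncard_insert_of_notMem heD]; omega)
    exact ⟨D', hD', (Set.subset_insert e D).trans h1, h2⟩

/-- Two good sets with a common good subset are joined by exchanges inside their union. -/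
theorem edgeChain_of_common {t : Prop} {k : ℕ} {B : Set G.edgeSet} (hB : B ∈ goodFamily G t k)
    (n : ℕ) : ∀ A ∈ goodFamily G t k, ∀ C, IsGood t C → C ⊆ A → C ⊆ B → C.ncard + n = k →
      Relation.ReflTransGen (EdgeStep (goodFamily G t k) (A ∪ B)) A B := by
  induction n with
  | zero =>
    intro A hA C _ hCA hCB hn
    have h1 : C = A := Set.eq_of_subset_of_ncard_le hCA (by rw [hA.1]; omega)
    have h2 : C = B := Set.eq_of_subset_of_ncard_le hCB (by rw [hB.1]; omega)
    rw [← h1, ← h2]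
  | succ n ih =>
    intro A hA C hC hCA hCB hn
    have hkB := hB.1
    have hkA := hA.1
    have hlt : C ⊂ B := Set.ssubset_iff_subset_ne.2 ⟨hCB, by rintro rfl; omega⟩
    obtain ⟨c, hcB, hcC, ⟨a, haC, hac⟩, hg⟩ := hC.grow hB.2.1 hlt fun h => by
      rw [hB.2.2 h]; omega
    have hcard : (insert c C).ncard + n = k := by
      rw [Set.ncard_insert_of_notMem hcC]; omega
    by_cases hcA : c ∈ A
    · exact ih A hA _ hg (Set.insert_subset hcA hCA) (Set.insert_subset hcB hCB) hcard
    -- `A` with `c` added is connected, so the good set `C` with `c` added grows inside it to a good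
    -- `D` of `k` edges. This `D` is one exchange away from `A` and shares a larger good set with
    -- `B`.
    · obtain ⟨D, hD, hCD, hDA⟩ := IsGood.extend (hA.2.1.insert_of_touch (hCA haC) hac) (k := k)
        (hkA ▸ Set.ncard_le_ncard (Set.subset_insert c A))
        (fun h => by
          have h1 := Set.ncard_le_ncard (supportingVertices_mono (Set.subset_insert c A))
          have h2 := hA.2.2 h
          omega)
        n _ hg (Set.insert_subset_insert hCA) hcard
      have hDAB : D ⊆ A ∪ B := hDA.trans
        (Set.insert_subset (Or.inr hcB) Set.subset_union_left)
      refine Relation.ReflTransGen.head ⟨hD, hDAB, c, hDA, a, hCA haC, hac⟩ ?_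
      exact Relation.ReflTransGen.mono (r := EdgeStep (goodFamily G t k) (D ∪ B))
        (fun _ _ h => ⟨h.1, h.2.1.trans (Set.union_subset hDAB Set.subset_union_right), h.2.2⟩)
        _ _ (ih D hD _ hg hCD (Set.insert_subset hcB hCB) hcard)

/-- The pair of touching edges `a`, `b` is good, and it grows to `k` edges inside the connected set
`A` with `b` added. A single edge suffices when `k = 1`. -/
theorem exists_goodFamily_attach {t : Prop} {k : ℕ} {A : Set G.edgeSet}
    (hA : A ∈ goodFamily G t k) {a b : G.edgeSet} (ha : a ∈ A) (hab : Touch a b) :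
    ∃ B ∈ goodFamily G t k, b ∈ B ∧ B ⊆ insert b A := by
  by_cases hb : b ∈ A
  · exact ⟨A, hA, hb, Set.subset_insert b A⟩
  have hk : 0 < k := hA.1 ▸ (Set.ncard_pos).2 ⟨a, ha⟩
  rcases (Nat.succ_le_of_lt hk).eq_or_lt with h1 | h2
  · exact ⟨{b}, ⟨by rw [Set.ncard_singleton]; omega, isGood_singleton t b⟩, rfl,
      Set.singleton_subset_iff.2 (Set.mem_insert b A)⟩
  · have hkA := hA.1
    have hne : a ≠ b := by rintro rfl; exact hb ha
    obtain ⟨D, hD, hCD, hDA⟩ := IsGood.extend (t := t) (hA.2.1.insert_of_touch ha hab) (k := k)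
      (hkA ▸ Set.ncard_le_ncard (Set.subset_insert b A))
      (fun h => by
        have h1 := Set.ncard_le_ncard (supportingVertices_mono (Set.subset_insert b A))
        have h2 := hA.2.2 h
        omega)
      (k - 2) _ (isGood_pair t hne hab)
      (Set.insert_subset_insert (Set.singleton_subset_iff.2 ha)) (by
        rw [Set.ncard_pair hne.symm]; omega)
    exact ⟨D, hD, hCD (Or.inl rfl), hDA⟩

theorem edgeChain_of_touch {t : Prop} {k : ℕ} {A B : Set G.edgeSet}
    (hA : A ∈ goodFamily G t k) (hB : B ∈ goodFamily G t k) {a b : G.edgeSet} (ha : a ∈ A)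
    (hb : b ∈ B) (hab : Touch a b) :
    Relation.ReflTransGen (EdgeStep (goodFamily G t k) (A ∪ B)) A B := by
  obtain ⟨D, hD, hbD, hDA⟩ := exists_goodFamily_attach hA ha hab
  have hDAB : D ⊆ A ∪ B := hDA.trans (Set.insert_subset (Or.inr hb) Set.subset_union_left)
  have hk : 0 < k := hA.1 ▸ (Set.ncard_pos).2 ⟨a, ha⟩
  refine Relation.ReflTransGen.head ⟨hD, hDAB, b, hDA, a, ha, hab⟩ ?_
  exact Relation.ReflTransGen.mono (r := EdgeStep (goodFamily G t k) (D ∪ B))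
    (fun _ _ h => ⟨h.1, h.2.1.trans (Set.union_subset hDAB Set.subset_union_right), h.2.2⟩)
    _ _ (edgeChain_of_common hB (k - 1) D hD {b} (isGood_singleton t b)
      (Set.singleton_subset_iff.2 hbD) (Set.singleton_subset_iff.2 hb)
      (by rw [Set.ncard_singleton]; omega))

end Edges

/-! ### From the graph families to the exchange property -/

section Connectedness

variable {U : Type*} {G : SimpleGraph U}

theorem supportedGraph_reachable {F : Set G.edgeSet} {e : G.edgeSet} (he : e ∈ F) {v w : U}
    (hv : v ∈ e.1) (hw : w ∈ e.1) (hvF : v ∈ supportingVertices G F)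
    (hwF : w ∈ supportingVertices G F) :
    (supportedGraph G F).Reachable ⟨v, hvF⟩ ⟨w, hwF⟩ := by
  by_cases hvw : v = w
  · subst hvw
    exact SimpleGraph.Reachable.refl _
  · refine SimpleGraph.Adj.reachable ?_
    exact edgeGraph_adj.2 ⟨e, he, (Sym2.mem_and_mem_iff hvw).1 ⟨hv, hw⟩⟩

theorem supportedGraph_connected_iff {F : Set G.edgeSet} :
    (supportedGraph G F).Connected ↔ LineConnected F := by
  constructor
  · intro h
    obtain ⟨u, hu⟩ := h.nonempty
    obtain ⟨e, he, -⟩ := mem_supportingVertices.1 hu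
    refine ⟨⟨e, he⟩, fun C hC ⟨c, hc⟩ => ?_⟩
    obtain ⟨f, hf, hfC⟩ := Set.exists_of_ssubset hC
    obtain ⟨v, hv⟩ := exists_mem_edge c
    obtain ⟨w, hw⟩ := exists_mem_edge f
    by_cases hwC : w ∈ supportingVertices G C
    · obtain ⟨d, hd, hwd⟩ := mem_supportingVertices.1 hwC
      exact ⟨d, hd, f, hf, hfC, w, hwd, hw⟩
    · obtain ⟨p⟩ := h.preconnected ⟨v, mem_supportingVertices.2 ⟨c, hC.1 hc, hv⟩⟩
        ⟨w, mem_supportingVertices.2 ⟨f, hf, hw⟩⟩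
      -- A walk from an edge of `C` to a vertex off `C` has a step leaving the vertices of `C`; the
      -- edge of that step is not in `C` but touches it.
      obtain ⟨d, -, h1, h2⟩ := p.exists_boundary_dart {x | x.1 ∈ supportingVertices G C}
        (mem_supportingVertices.2 ⟨c, hc, hv⟩) hwC
      obtain ⟨g, hg, hgd⟩ := edgeGraph_adj.1 (show (edgeGraph G F).Adj d.fst.1 d.snd.1 from d.adj)
      obtain ⟨c', hc', hdc'⟩ := mem_supportingVertices.1 h1
      exact ⟨c', hc', g, hg, fun hgC => h2 (mem_supportingVertices.2
        ⟨g, hgC, hgd ▸ Sym2.mem_mk_right _ _⟩), d.fst.1, hdc', hgd ▸ Sym2.mem_mk_left _ _⟩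
  · rintro ⟨⟨e, he⟩, h⟩
    obtain ⟨u, hu⟩ := exists_mem_edge e
    have huF : u ∈ supportingVertices G F := mem_supportingVertices.2 ⟨e, he, hu⟩
    let C : Set G.edgeSet := {f | f ∈ F ∧ ∀ v ∈ f.1, ∀ hv : v ∈ supportingVertices G F,
      (supportedGraph G F).Reachable ⟨u, huF⟩ ⟨v, hv⟩}
    have hCF : C = F := by
      by_contra hne
      obtain ⟨c, hc, f, hf, hfC, v, hvc, hvf⟩ := h C
        (Set.ssubset_iff_subset_ne.2 ⟨fun f hf => hf.1, hne⟩)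
        ⟨e, he, fun v hv hvF => supportedGraph_reachable he hu hv huF hvF⟩
      have hvF : v ∈ supportingVertices G F := mem_supportingVertices.2 ⟨f, hf, hvf⟩
      exact hfC ⟨hf, fun w hw hwF => (hc.2 v hvc hvF).trans
        (supportedGraph_reachable hf hvf hw hvF hwF)⟩
    rw [SimpleGraph.connected_iff_exists_forall_reachable]
    refine ⟨⟨u, huF⟩, fun ⟨v, hv⟩ => ?_⟩
    obtain ⟨f, hf, hvf⟩ := mem_supportingVertices.1 hv
    rw [← hCF] at hf
    exact hf.2 v hvf hv

theorem natCard_edgeSet_supportedGraph (F : Set G.edgeSet) :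
    Nat.card (supportedGraph G F).edgeSet = F.ncard := by
  have h : Sym2.map Subtype.val '' (supportedGraph G F).edgeSet = Subtype.val '' F := by
    ext z
    constructor
    · rintro ⟨z, hz, rfl⟩
      induction z using Sym2.ind with
      | _ a b =>
        obtain ⟨e, he, h⟩ := edgeGraph_adj.1 (show (edgeGraph G F).Adj a.1 b.1 from hz)
        exact ⟨e, he, h⟩
    · rintro ⟨e, he, rfl⟩
      obtain ⟨v, hv⟩ := exists_mem_edge e
      obtain ⟨w, hw, -⟩ := exists_eq_of_mem e hv
      have hwe : w ∈ e.1 := hw ▸ Sym2.mem_mk_right v w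
      refine ⟨s(⟨v, mem_supportingVertices.2 ⟨e, he, hv⟩⟩,
        ⟨w, mem_supportingVertices.2 ⟨e, he, hwe⟩⟩), ?_, by simp [hw]⟩
      rw [SimpleGraph.mem_edgeSet]
      exact edgeGraph_adj.2 ⟨e, he, hw⟩
  rw [Nat.card_coe_set_eq, ← Set.ncard_image_of_injective _
    (Sym2.map.injective (Subtype.val_injective (p := (· ∈ supportingVertices G F)))), h,
    Set.ncard_image_of_injective _ Subtype.val_injective]

theorem edgeConnected_eq (G : SimpleGraph U) (k : ℕ) :
    edgeConnected G k = goodFamily G False k := by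
  ext F
  simp [edgeConnected, goodFamily, IsGood, supportedGraph_connected_iff]

theorem edgeTree_eq [Finite U] (G : SimpleGraph U) (k : ℕ) :
    edgeTree G k = goodFamily G True k := by
  ext F
  change _ ∧ (supportedGraph G F).IsTree ↔ _ ∧ LineConnected F ∧ (True → _)
  rw [SimpleGraph.isTree_iff_connected_and_card, supportedGraph_connected_iff,
    natCard_edgeSet_supportedGraph, Nat.card_coe_set_eq, true_imp_iff, eq_comm (a := F.ncard + 1)]

theorem exists_adj_of_connected (hG : G.Connected) {C : Set U} (hne : C.Nonempty)
    (hu : C ≠ Set.univ) : ∃ a ∈ C, ∃ c ∉ C, G.Adj a c := by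
  obtain ⟨a, ha⟩ := hne
  obtain ⟨b, hb⟩ := (Set.ne_univ_iff_exists_notMem C).1 hu
  obtain ⟨p⟩ := hG.preconnected a b
  obtain ⟨d, -, h1, h2⟩ := p.exists_boundary_dart C ha hb
  exact ⟨d.fst, h1, d.snd, h2, d.adj⟩

theorem exists_touch_of_connected (hG : G.Connected) {C : Set G.edgeSet} (hne : C.Nonempty)
    (hu : C ≠ Set.univ) : ∃ a ∈ C, ∃ c ∉ C, Touch a c := by
  obtain ⟨e, he⟩ := hne
  obtain ⟨v, hv⟩ := exists_mem_edge e
  by_cases h : supportingVertices G C = Set.univ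
  · obtain ⟨f, hf⟩ := (Set.ne_univ_iff_exists_notMem C).1 hu
    obtain ⟨w, hw⟩ := exists_mem_edge f
    obtain ⟨a, ha, hwa⟩ := mem_supportingVertices.1 (h ▸ Set.mem_univ w)
    exact ⟨a, ha, f, hf, w, hwa, hw⟩
  · obtain ⟨x, hx, y, hy, hxy⟩ := exists_adj_of_connected hG
      ⟨v, mem_supportingVertices.2 ⟨e, he, hv⟩⟩ h
    obtain ⟨a, ha, hxa⟩ := mem_supportingVertices.1 hx
    exact ⟨a, ha, ⟨s(x, y), hxy⟩,
      fun h => hy (mem_supportingVertices.2 ⟨_, h, Sym2.mem_mk_right x y⟩), x, hxa,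
      Sym2.mem_mk_left x y⟩

variable [Finite U]

theorem hasExchange_goodFamily (hG : G.Connected) (t : Prop) {k : ℕ} (hk : 2 ≤ k) :
    HasExchange (goodFamily G t k) where
  nontrivial A hA := by
    rw [← Set.one_lt_ncard_iff_nontrivial, hA.1]
    omega
  chain A hA B hB := by
    rintro ⟨a, haA, haB⟩
    exact Relation.ReflTransGen.mono (r := EdgeStep (goodFamily G t k) (A ∪ B))
      (fun _ _ ⟨h1, h2, c, h3, _⟩ => ⟨h1, h2, c, h3⟩) _ _
      (edgeChain_of_touch hA hB haA haB (Touch.refl a))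
  attach C hne hu := by
    obtain ⟨a, ha, c, hc, hac⟩ := exists_touch_of_connected hG hne hu
    exact ⟨a, ha, c, hc, fun A hA haA => exists_goodFamily_attach hA haA hac⟩

/-- Sharing a vertex means that the underlying edge sets touch, so `edgeChain_of_touch` gives an
edge chain, whose image under `supportingVertices` is an exchange chain. -/
theorem hasExchange_image_goodFamily (hG : G.Connected) (t : Prop) (k : ℕ) :
    HasExchange (supportingVertices G '' goodFamily G t k) where
  nontrivial := by
    rintro _ ⟨F, hF, rfl⟩
    obtain ⟨e, he⟩ := hF.2.1.1
    obtain ⟨v, hv⟩ := exists_mem_edge e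
    obtain ⟨w, hw, hadj⟩ := exists_eq_of_mem e hv
    exact ⟨v, mem_supportingVertices.2 ⟨e, he, hv⟩, w,
      mem_supportingVertices.2 ⟨e, he, hw ▸ Sym2.mem_mk_right v w⟩, hadj.ne⟩
  chain := by
    rintro _ ⟨A, hA, rfl⟩ _ ⟨B, hB, rfl⟩ ⟨v, hvA, hvB⟩
    obtain ⟨a, ha, hva⟩ := mem_supportingVertices.1 hvA
    obtain ⟨b, hb, hvb⟩ := mem_supportingVertices.1 hvB
    refine Relation.ReflTransGen.lift (r := EdgeStep (goodFamily G t k) (A ∪ B))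
      (supportingVertices G) (fun C D hCD => ?_) _ _
      (edgeChain_of_touch hA hB ha hb ⟨v, hva, hvb⟩)
    obtain ⟨hD, hDS, c, hDC, d, hd, hdc⟩ := hCD
    refine ⟨⟨D, hD, rfl⟩, fun u hu => ?_, ?_⟩
    · obtain ⟨e, he, hue⟩ := mem_supportingVertices.1 hu
      exact (hDS he).imp (fun h => mem_supportingVertices.2 ⟨e, h, hue⟩)
        fun h => mem_supportingVertices.2 ⟨e, h, hue⟩
    · obtain ⟨w, hw⟩ := exists_supportingVertices_insert_eq hd hdc
      exact ⟨w, hw ▸ supportingVertices_mono hDC⟩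
  attach C hne hu := by
    obtain ⟨a, ha, c, hc, hac⟩ := exists_adj_of_connected hG hne hu
    refine ⟨a, ha, c, hc, ?_⟩
    rintro _ ⟨A, hA, rfl⟩ haA
    obtain ⟨e, he, hae⟩ := mem_supportingVertices.1 haA
    obtain ⟨B, hB, hcB, hBA⟩ := exists_goodFamily_attach hA (b := ⟨s(a, c), hac⟩) he
      ⟨a, hae, Sym2.mem_mk_left a c⟩
    refine ⟨_, ⟨B, hB, rfl⟩, mem_supportingVertices.2 ⟨_, hcB, Sym2.mem_mk_right a c⟩, ?_⟩
    rw [← supportingVertices_insert (e := ⟨s(a, c), hac⟩) he hae rfl]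
    exact supportingVertices_mono hBA

end Connectedness

end HypergraphNim

theorem mainTheorem6 {U : Type*} [Finite U] (G : SimpleGraph U) (hG : G.Connected) (k : ℕ) :
    (2 ≤ k →
      (HypergraphNim.MinimalTransversalFree (HypergraphNim.edgeConnected G k) →
        HypergraphNim.IsJM (HypergraphNim.edgeConnected G k)) ∧
      (HypergraphNim.MinimalTransversalFree (HypergraphNim.edgeTree G k) →
        HypergraphNim.IsJM (HypergraphNim.edgeTree G k))) ∧
    (1 ≤ k →
      (HypergraphNim.MinimalTransversalFree (HypergraphNim.vertexConnected G k) →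
        HypergraphNim.IsJM (HypergraphNim.vertexConnected G k)) ∧
      (HypergraphNim.MinimalTransversalFree (HypergraphNim.vertexTree G k) →
        HypergraphNim.IsJM (HypergraphNim.vertexTree G k))) := by
  unfold HypergraphNim.vertexConnected HypergraphNim.vertexTree
  rw [HypergraphNim.edgeConnected_eq, HypergraphNim.edgeTree_eq]
  exact ⟨fun hk => ⟨(HypergraphNim.hasExchange_goodFamily hG False hk).isJM,
      (HypergraphNim.hasExchange_goodFamily hG True hk).isJM⟩,
    fun _ => ⟨(HypergraphNim.hasExchange_image_goodFamily hG False k).isJM,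
      (HypergraphNim.hasExchange_image_goodFamily hG True k).isJM⟩⟩
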